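/- Let $\mathbf H$ be the quaternions with units $i,j,k$ and norm $|\cdot|$. For $m=1,2$ let $A_m=(a_m,b_m,c_m,d_m\,|\,r_m,s_m)$ be real parameters with $a_md_m-b_mc_m=1$. For $\mu\in\{i,j\}$ put, with principal square roots taken in the plane $\mathbf R+\mathbf R\mu\cong\mathbf C$, $$K^{\mu}_{A}(x,v)=\frac{1}{\sqrt{2\pi b\mu}}\,e^{\frac{\mu}{2b}\left[ax^2+2x(r-v)-2v(dr-bs)+d(v^2+r^2)\right]}\quad(b\neq 0),\qquad C^{\mu}_{A}(v)=\sqrt{d}\,e^{\mu\left(\frac{cd}{2}(v-r)^2+vr\right)}\quad(b=0).$$ For $f,g\in L^2(\mathbf R^2,\mathbf H)$ put $h_{f,g}(t,n)=f(t+\tfrac n2)\,\overline{g(t-\tfrac n2)}$. The Wigner–Ville distribution of $f,g$ associated with the two-sided quaternionic offset linear canonical transform (WVD-QOLCT) is defined, for $t=(t_1,t_2)$ and $u=(u_1,u_2)$ in $\mathbf R^2$, by $$\mathcal W^{A_1,A_2}_{f,g}(t,u)=\begin{cases}\displaystyle\int_{\mathbf R^2}K^i_{A_1}(n_1,u_1)\,h_{f,g}(t,n)\,K^j_{A_2}(n_2,u_2)\,dn,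 & b_1,b_2\ne0,\\[1ex] \displaystyle\int_{\mathbf R}C^i_{A_1}(u_1)\,h_{f,g}\big(t,(d_1(u_1-r_1),n_2)\big)\,K^j_{A_2}(n_2,u_2)\,dn_2, & b_1=0,\ b_2\neq0,\\[1ex] \displaystyle\int_{\mathbf R}K^i_{A_1}(n_1,u_1)\,h_{f,g}\big(t,(n_1,d_2(u_2-r_2))\big)\,C^j_{A_2}(u_2)\,dn_1, & b_1\neq0,\ b_2=0,\\[1ex] C^i_{A_1}(u_1)\,h_{f,g}\big(t,(d_1(u_1-r_1),d_2(u_2-r_2))\big)\,C^j_{A_2}(u_2), & b_1=b_2=0\end{cases}$$ (in the second and third cases the integral converges absolutely for almost every $(t,u)$, and $\mathcal W^{A_1,A_2}_{f,g}(t,u)$ is set to $0$ where it does not). **Theorem (Plancherel's theorem for the WVD-QOLCT).** For all $f,g\in L^2(\mathbf R^2,\mathbf H)$, the function $\mathcal W^{A_1,A_2}_{f,g}$ belongs to $L^2(\mathbf R^2\times\mathbf R^2,\mathbf H)$ and $$\int_{\mathbf R^2}\int_{\mathbf R^2}\big|\mathcal W^{A_1,A_2}_{f,g}(t,u)\big|^2\,du\,dt=\big\|\mathcal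 W^{A_1,A_2}_{f,g}\big\|^2_{L^2(\mathbf R^2\times\mathbf R^2,\mathbf H)}=\|f\|^2_{L^2(\mathbf R^2,\mathbf H)}\,\|g\|^2_{L^2(\mathbf R^2,\mathbf H)}.$$ -/

import Mathlib

open MeasureTheory

open scoped Quaternion

/-- Parameters `(a, b, c, d | r, s)` of an offset linear canonical transform, with
`a * d - b * c = 1`. -/
structure OLCTParam where
  a : ℝ
  b : ℝ
  c : ℝ
  d : ℝ
  r : ℝ
  s : ℝ
  det_eq_one : a * d - b * c = 1

/-- The quaternion unit `i`. -/
def quatI : ℍ := ⟨0, 1, 0, 0⟩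

/-- The quaternion unit `j`. -/
def quatJ : ℍ := ⟨0, 0, 1, 0⟩

/-- For a quaternion `μ` with `μ ^ 2 = -1`, the copy `x + y μ` of the complex number `x + y i`
in the plane spanned by `1` and `μ`. -/
noncomputable def inPlane (μ : ℍ) (z : ℂ) : ℍ := (z.re : ℍ) + z.im • μ

/-- The kernel of the offset linear canonical transform for `b ≠ 0`, as a complex number:
`(2 π b i)^(-1/2) * exp (i / (2 b) * (a x² + 2 x (r - u) - 2 u (d r - b s) + d (u² + r²)))`,
with the principal square root. -/
noncomputable def olctKernelC (A : OLCTParam) (x u : ℝ) : ℂ :=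
  1 / (2 * (Real.pi : ℂ) * (A.b : ℂ) * Complex.I) ^ (1 / 2 : ℂ) *
    Complex.exp (Complex.I / (2 * (A.b : ℂ)) *
      ((A.a * x ^ 2 + 2 * x * (A.r - u) - 2 * u * (A.d * A.r - A.b * A.s)
        + A.d * (u ^ 2 + A.r ^ 2) : ℝ) : ℂ))

/-- The chirp factor that replaces the kernel when `b = 0`:
`√d * exp (i (c d / 2 * (u - r)² + u r))`, with the principal square root. -/
noncomputable def olctChirpC (A : OLCTParam) (u : ℝ) : ℂ :=
  (A.d : ℂ) ^ (1 / 2 : ℂ) *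
    Complex.exp (Complex.I *
      ((A.c * A.d / 2 * (u - A.r) ^ 2 + u * A.r : ℝ) : ℂ))

/-- The quaternion kernel `K_A^μ(x, u)`, with values in the plane spanned by `1` and `μ`. -/
noncomputable def quatKernel (μ : ℍ) (A : OLCTParam) (x u : ℝ) : ℍ :=
  inPlane μ (olctKernelC A x u)

/-- The quaternion chirp, with values in the plane spanned by `1` and `μ`. -/
noncomputable def quatChirp (μ : ℍ) (A : OLCTParam) (u : ℝ) : ℍ :=
  inPlane μ (olctChirpC A u)

/-- The quaternion correlation product `h_{f,g}(t, n) = f(t + n/2) * conj (g(t - n/2))`. -/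
noncomputable def corrProduct (f g : ℝ × ℝ → ℍ) (t n : ℝ × ℝ) : ℍ :=
  f (t + (1 / 2 : ℝ) • n) * star (g (t - (1 / 2 : ℝ) • n))

/-- The (cross) Wigner-Ville distribution of `f` and `g` associated with the two-sided
quaternionic offset linear canonical transform. If `b₁ = 0` or `b₂ = 0`, the integration over the
corresponding variable `nₖ` is replaced by evaluation at `nₖ = dₖ (uₖ - rₖ)` and multiplication
by the chirp. -/
noncomputable def wvdQOLCT (A₁ A₂ : OLCTParam) (f g : ℝ × ℝ → ℍ) (t u : ℝ × ℝ) : ℍ :=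
  if A₁.b = 0 then
    if A₂.b = 0 then
      quatChirp quatI A₁ u.1 *
        corrProduct f g t (A₁.d * (u.1 - A₁.r), A₂.d * (u.2 - A₂.r)) *
        quatChirp quatJ A₂ u.2
    else
      ∫ n₂ : ℝ, quatChirp quatI A₁ u.1 *
        corrProduct f g t (A₁.d * (u.1 - A₁.r), n₂) *
        quatKernel quatJ A₂ n₂ u.2
  else
    if A₂.b = 0 then
      ∫ n₁ : ℝ, quatKernel quatI A₁ n₁ u.1 *
        corrProduct f g t (n₁, A₂.d * (u.2 - A₂.r)) *
        quatChirp quatJ A₂ u.2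
    else
      ∫ n : ℝ × ℝ, quatKernel quatI A₁ n.1 u.1 *
        corrProduct f g t n *
        quatKernel quatJ A₂ n.2 u.2

/-!
Left multiplication by the plane `ℝ + ℝi` and right multiplication by the plane `ℝ + ℝj` each turn
`ℍ` into a complex Hilbert space. The two-sided transform of a quaternion-valued function is
therefore a one-dimensional offset linear canonical transform in `n₁`, taken with respect to the
first complex structure, followed by one in `n₂`, taken with respect to the second. Each of them is
isometric on `L²`: for `b ≠ 0` it is a Fourier transform up to chirps and a dilation, for `b = 0` a
dilation times a chirp. Finally `(t, n) ↦ (t + n/2, t - n/2)` preserves the measure, so that the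
correlation product has `L²` norm `‖f‖ ‖g‖`.
-/

section SquareIntegrable

variable {X Y E : Type*} [MeasurableSpace X] [MeasurableSpace Y] [NormedAddCommGroup E]
  {μ : Measure X} {ν : Measure Y}

theorem lintegral_enorm_sq_eq_eLpNorm_sq (f : X → E) (μ : Measure X) :
    ∫⁻ x, ‖f x‖ₑ ^ 2 ∂μ = eLpNorm f 2 μ ^ 2 := by
  simpa using (eLpNorm_nnreal_pow_eq_lintegral (f := f) (μ := μ) (p := 2) two_ne_zero).symm

theorem memLp_two_of_lintegral_enorm_sq_ne_top {f : X → E} (hf : AEStronglyMeasurable f μ)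
    (hfin : ∫⁻ x, ‖f x‖ₑ ^ 2 ∂μ ≠ ⊤) : MemLp f 2 μ := by
  rw [lintegral_enorm_sq_eq_eLpNorm_sq, ENNReal.pow_ne_top_iff] at hfin
  exact ⟨hf, (hfin.resolve_right two_ne_zero).lt_top⟩

theorem lintegral_enorm_sq_ne_top {f : X → E} (hf : MemLp f 2 μ) :
    ∫⁻ x, ‖f x‖ₑ ^ 2 ∂μ ≠ ⊤ := by
  rw [lintegral_enorm_sq_eq_eLpNorm_sq]
  exact ENNReal.pow_ne_top hf.2.ne

theorem ae_memLp_two_prodMk_left [SFinite μ] [SFinite ν] {h : X × Y → E}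
    (hh : MemLp h 2 (μ.prod ν)) : ∀ᵐ x ∂μ, MemLp (fun y => h (x, y)) 2 ν := by
  filter_upwards [hh.1.prodMk_left, ((memLp_two_iff_integrable_sq_norm hh.1).mp hh).prod_right_ae]
    with x hx hsq
  exact (memLp_two_iff_integrable_sq_norm hx).mpr hsq

theorem integral_integral_norm_sq_eq_eLpNorm_sq [SFinite μ] [SFinite ν] {h : X × Y → E}
    (hh : MemLp h 2 (μ.prod ν)) :
    ∫ x, ∫ y, ‖h (x, y)‖ ^ 2 ∂ν ∂μ = (eLpNorm h 2 (μ.prod ν)).toReal ^ 2 := by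
  have hsq := (memLp_two_iff_integrable_sq_norm hh.1).mp hh
  rw [← integral_prod _ hsq, ← ENNReal.toReal_pow, ← lintegral_enorm_sq_eq_eLpNorm_sq,
    integral_eq_lintegral_of_nonneg_ae (.of_forall fun p => by positivity) hsq.1]
  simp_rw [ENNReal.ofReal_pow (norm_nonneg _), ofReal_norm]

end SquareIntegrable

section Plancherel

open FourierTransform SchwartzMap

variable {V E : Type*} [NormedAddCommGroup V] [InnerProductSpace ℝ V] [FiniteDimensional ℝ V]
  [MeasurableSpace V] [BorelSpace V] [NormedAddCommGroup E]

theorem continuous_fourier_of_integrable [NormedSpace ℂ E] {G : V → E} (hG : Integrable G) :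
    Continuous (𝓕 G) :=
  VectorFourier.fourierIntegral_continuous Real.continuous_fourierChar
    (L := innerₗ V) continuous_inner hG

theorem integral_smul_fourier_eq [NormedSpace ℂ E] [CompleteSpace E] (ψ : 𝓢(V, ℂ)) {G : V → E}
    (hG : Integrable G) : ∫ x, ψ x • 𝓕 G x = ∫ x, 𝓕 ψ x • G x := by
  simpa using! (VectorFourier.integral_fourierIntegral_smul_eq_flip (L := innerₗ V)
    Real.continuous_fourierChar continuous_inner ψ.integrable hG).symm

variable [InnerProductSpace ℂ E] [CompleteSpace E]

theorem integral_smul_fourier_toLp_eq (ψ : 𝓢(V, ℂ)) {G : V → E} (hG : MemLp G 2) :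
    ∫ x, ψ x • (𝓕 (hG.toLp G) : Lp E 2 (volume : Measure V)) x = ∫ x, 𝓕 ψ x • G x := by
  have hdistr := congrArg (fun T => T ψ) (Lp.fourier_toTemperedDistribution_eq (hG.toLp G))
  simp only [TemperedDistribution.fourier_apply, Lp.toTemperedDistribution_apply] at hdistr
  rw [← hdistr]
  refine integral_congr_ae ?_
  filter_upwards [hG.coeFn_toLp] with x hx
  rw [hx]

-- Both sides are locally integrable and define the same tempered distribution.
theorem fourier_ae_eq_fourier_toLp {G : V → E} (hG : Integrable G) (hG₂ : MemLp G 2) :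
    𝓕 G =ᵐ[volume] (𝓕 (hG₂.toLp G) : Lp E 2 (volume : Measure V)) := by
  set H : Lp E 2 (volume : Measure V) := 𝓕 (hG₂.toLp G)
  have hFloc : LocallyIntegrable (𝓕 G) :=
    (continuous_fourier_of_integrable hG).locallyIntegrable
  have hHloc : LocallyIntegrable H := (Lp.memLp H).locallyIntegrable (by norm_num)
  have hzero : ∀ᵐ x, 𝓕 G x - H x = 0 := by
    refine ae_eq_zero_of_integral_contDiff_smul_eq_zero (hFloc.sub hHloc) fun φ hφ hφc => ?_
    have hψc : HasCompactSupport (Complex.ofRealCLM ∘ φ) := hφc.comp_left rfl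
    set ψ : 𝓢(V, ℂ) := hψc.toSchwartzMap (by fun_prop) with hψ
    have hψφ (x : V) : ψ x = (φ x : ℂ) := by simp [hψ]
    have hpair := (integral_smul_fourier_eq ψ hG).trans (integral_smul_fourier_toLp_eq ψ hG₂).symm
    simp only [smul_sub]
    rw [integral_sub (hFloc.integrable_smul_left_of_hasCompactSupport hφ.continuous hφc)
      (hHloc.integrable_smul_left_of_hasCompactSupport hφ.continuous hφc), sub_eq_zero]
    simpa only [hψφ, Complex.coe_smul] using hpair
  filter_upwards [hzero] with x hx using sub_eq_zero.mp hx

theorem lintegral_enorm_sq_fourier {G : V → E} (hG : Integrable G) (hG₂ : MemLp G 2) :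
    ∫⁻ ξ, ‖𝓕 G ξ‖ₑ ^ 2 = ∫⁻ x, ‖G x‖ₑ ^ 2 := by
  rw [lintegral_enorm_sq_eq_eLpNorm_sq, lintegral_enorm_sq_eq_eLpNorm_sq,
    eLpNorm_congr_ae (fourier_ae_eq_fourier_toLp hG hG₂), ← eLpNorm_congr_ae hG₂.coeFn_toLp,
    ← Lp.enorm_def, ← Lp.enorm_def, ← ofReal_norm, ← ofReal_norm, Lp.norm_fourier_eq]

end Plancherel

section Dilation

variable {a : ℝ}

theorem ofReal_abs_mul_lintegral_comp_mul_sub (F : ℝ → ENNReal) (ha : a ≠ 0) (r : ℝ) :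
    ENNReal.ofReal |a| * ∫⁻ x, F (a * (x - r)) = ∫⁻ x, F x := by
  have hmap : ∫⁻ x, F x ∂(volume.map (a * ·)) = ∫⁻ x, F (a * x) :=
    lintegral_map_equiv F (MeasurableEquiv.mulLeft₀ a ha)
  rw [lintegral_sub_right_eq_self (fun x => F (a * x)) r, ← hmap, ← smul_eq_mul,
    ← lintegral_smul_measure, Real.smul_map_volume_mul_left ha]

theorem quasiMeasurePreserving_mul_sub (ha : a ≠ 0) (r : ℝ) :
    Measure.QuasiMeasurePreserving (fun x : ℝ => a * (x - r)) := by
  have hmul : Measure.QuasiMeasurePreserving (fun x : ℝ => a * x) :=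
    ⟨by fun_prop, Real.map_volume_mul_left ha ▸ Measure.smul_absolutelyContinuous⟩
  exact hmul.comp (measurePreserving_sub_right volume r).quasiMeasurePreserving

end Dilation

section OLCTKernel

open FourierTransform

variable {E : Type*} [NormedAddCommGroup E] [NormedSpace ℂ E]

theorem continuous_olctKernelC {X : Type*} [TopologicalSpace X] (A : OLCTParam) {n u : X → ℝ}
    (hn : Continuous n) (hu : Continuous u) : Continuous fun x => olctKernelC A (n x) (u x) := by
  unfold olctKernelC
  fun_prop

theorem continuous_olctChirpC (A : OLCTParam) : Continuous (olctChirpC A) := by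
  unfold olctChirpC
  fun_prop

theorem norm_sq_olctChirpC (A : OLCTParam) (u : ℝ) : ‖olctChirpC A u‖ ^ 2 = |A.d| := by
  rw [olctChirpC, norm_mul, mul_comm Complex.I, Complex.norm_exp_ofReal_mul_I, mul_one,
    ← norm_pow, ← Complex.cpow_nat_mul]
  simp

theorem norm_sq_olctKernelC (A : OLCTParam) (n u : ℝ) :
    ‖olctKernelC A n u‖ ^ 2 = |(2 * Real.pi * A.b)⁻¹| := by
  have hphase (x y : ℝ) : ‖Complex.exp (Complex.I / (2 * (y : ℂ)) * x)‖ = 1 := by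
    rw [← Complex.norm_exp_ofReal_mul_I (x / (2 * y))]
    push_cast
    ring_nf
  rw [olctKernelC, norm_mul, hphase, mul_one, ← norm_pow, div_pow, ← Complex.cpow_nat_mul]
  simp [abs_mul]

theorem d_ne_zero_of_b_eq_zero {A : OLCTParam} (hb : A.b = 0) : A.d ≠ 0 := by
  intro hd
  have hdet := A.det_eq_one
  simp [hb, hd] at hdet

/-- The unimodular chirp `exp (i (a n² + 2 n r) / (2 b))` by which a function is multiplied before
its Fourier transform is taken. -/
noncomputable def olctPhase (A : OLCTParam) (n : ℝ) : ℂ :=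
  Complex.exp (((A.a * n ^ 2 + 2 * n * A.r) / (2 * A.b) : ℝ) * Complex.I)

theorem norm_olctPhase (A : OLCTParam) (n : ℝ) : ‖olctPhase A n‖ = 1 :=
  Complex.norm_exp_ofReal_mul_I _

theorem continuous_olctPhase (A : OLCTParam) : Continuous (olctPhase A) := by
  unfold olctPhase
  fun_prop

theorem olctKernelC_eq_mul {A : OLCTParam} (hb : A.b ≠ 0) (n u : ℝ) :
    olctKernelC A n u = olctKernelC A 0 u *
      (Complex.exp ((-2 * Real.pi * n * ((2 * Real.pi * A.b)⁻¹ * u) : ℝ) * Complex.I) *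
        olctPhase A n) := by
  have hb' : (A.b : ℂ) ≠ 0 := by exact_mod_cast hb
  have hpi : (Real.pi : ℂ) ≠ 0 := by exact_mod_cast Real.pi_ne_zero
  rw [olctKernelC, olctKernelC, olctPhase, mul_assoc (_ / _), ← Complex.exp_add, ← Complex.exp_add]
  congr 2
  push_cast
  field_simp
  ring

theorem integral_olctKernelC_smul {A : OLCTParam} (hb : A.b ≠ 0) (h : ℝ → E) (u : ℝ) :
    ∫ n, olctKernelC A n u • h n =
      olctKernelC A 0 u • 𝓕 (fun n => olctPhase A n • h n) ((2 * Real.pi * A.b)⁻¹ * u) := by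
  rw [Real.fourier_real_eq_integral_exp_smul, ← integral_smul]
  refine integral_congr_ae (.of_forall fun n => ?_)
  simp only [olctKernelC_eq_mul hb n u, smul_smul]

end OLCTKernel

section OneVariable

open FourierTransform

variable {E F Y : Type*} [NormedAddCommGroup F] [NormedSpace ℝ F] [NormedAddCommGroup E]
  [MeasurableSpace Y]

/-- The one-dimensional offset linear canonical transform of an `F`-valued function, where `T z q`
is the product of the vector `q` by the complex scalar `z`. Passing `T` as an argument allows for
several complex structures on the same space. -/
noncomputable def olct (T : ℂ → F → F) (A : OLCTParam) (h : ℝ → F) (u : ℝ) : F :=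
  if A.b = 0 then T (olctChirpC A u) (h (A.d * (u - A.r))) else ∫ n, T (olctKernelC A n u) (h n)

/-- The operation `T` is the scalar multiplication of a complex structure on `F`, exhibited by the
isometry `φ` of `F` into a complex normed space. -/
def IsComplexScaling [NormedSpace ℂ E] (φ : F →ₗᵢ[ℝ] E) (T : ℂ → F → F) : Prop :=
  ∀ z q, φ (T z q) = z • φ q

theorem lintegral_enorm_sq_olct_smul [InnerProductSpace ℂ E] [CompleteSpace E] (A : OLCTParam)
    {h : ℝ → E} (hh : Integrable h) (hh₂ : MemLp h 2) :
    ∫⁻ u, ‖olct (· • ·) A h u‖ₑ ^ 2 = ∫⁻ n, ‖h n‖ₑ ^ 2 := by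
  have henorm {z : ℂ} {c : ℝ} (hz : ‖z‖ ^ 2 = |c|) (x : E) :
      ‖z • x‖ₑ ^ 2 = ENNReal.ofReal |c| * ‖x‖ₑ ^ 2 := by
    rw [enorm_smul, mul_pow, ← hz, ENNReal.ofReal_pow (norm_nonneg z), ofReal_norm]
  by_cases hb : A.b = 0
  · simp_rw [olct, if_pos hb, henorm (norm_sq_olctChirpC A _)]
    rw [lintegral_const_mul' _ _ ENNReal.ofReal_ne_top,
      ofReal_abs_mul_lintegral_comp_mul_sub (fun n => ‖h n‖ₑ ^ 2) (d_ne_zero_of_b_eq_zero hb)]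
  · set G : ℝ → E := fun n => olctPhase A n • h n
    have hGae : AEStronglyMeasurable G :=
      (continuous_olctPhase A).aestronglyMeasurable.smul hh.aestronglyMeasurable
    have hGnorm (n : ℝ) : ‖G n‖ = ‖h n‖ := by rw [norm_smul, norm_olctPhase, one_mul]
    have hG : Integrable G := hh.congr' hGae (.of_forall fun n => (hGnorm n).symm)
    have hG₂ : MemLp G 2 := hh₂.congr_norm hGae (.of_forall fun n => (hGnorm n).symm)
    have hscale : (2 * Real.pi * A.b)⁻¹ ≠ 0 := by positivity
    simp_rw [olct, if_neg hb, integral_olctKernelC_smul hb, henorm (norm_sq_olctKernelC A _ _)]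
    rw [lintegral_const_mul' _ _ ENNReal.ofReal_ne_top]
    have hdil := ofReal_abs_mul_lintegral_comp_mul_sub (fun ξ => ‖𝓕 G ξ‖ₑ ^ 2) hscale 0
    simp only [sub_zero] at hdil
    rw [hdil, lintegral_enorm_sq_fourier hG hG₂]
    simp_rw [← ofReal_norm, hGnorm]

namespace IsComplexScaling

section

variable [NormedSpace ℂ E] {φ : F →ₗᵢ[ℝ] E} {T : ℂ → F → F}

theorem norm_apply (hT : IsComplexScaling φ T) (z : ℂ) (q : F) : ‖T z q‖ = ‖z‖ * ‖q‖ := by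
  rw [← φ.norm_map, hT, norm_smul, φ.norm_map]

theorem continuous (hT : IsComplexScaling φ T) : Continuous fun p : ℂ × F => T p.1 p.2 := by
  rw [φ.isometry.isEmbedding.continuous_iff]
  simp_rw [Function.comp_def, hT _ _]
  exact continuous_fst.smul (φ.continuous.comp continuous_snd)

theorem map_olct [CompleteSpace E] [CompleteSpace F] (hT : IsComplexScaling φ T)
    (A : OLCTParam) (h : ℝ → F) (u : ℝ) : φ (olct T A h u) = olct (· • ·) A (φ ∘ h) u := by
  simp_rw [olct, apply_ite φ, ← φ.integral_comp_comm, hT _ _, Function.comp_apply]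

theorem aestronglyMeasurable_apply {X : Type*} [MeasurableSpace X] {μ : Measure X}
    (hT : IsComplexScaling φ T) {k : X → ℂ} {h : X → F} (hk : AEStronglyMeasurable k μ)
    (hh : AEStronglyMeasurable h μ) : AEStronglyMeasurable (fun x => T (k x) (h x)) μ :=
  hT.continuous.comp_aestronglyMeasurable (hk.prodMk hh)

theorem integrable_apply {X : Type*} [MeasurableSpace X] {μ : Measure X}
    (hT : IsComplexScaling φ T) {k : X → ℂ} {h : X → F} (hk : AEStronglyMeasurable k μ) {c : ℝ}
    (hc : ∀ x, ‖k x‖ ^ 2 = c) (hh : Integrable h μ) : Integrable (fun x => T (k x) (h x)) μ := by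
  refine (hh.norm.const_mul √c).mono' (hT.aestronglyMeasurable_apply hk hh.1) (.of_forall ?_)
  intro x
  rw [hT.norm_apply, ← hc x, Real.sqrt_sq (norm_nonneg _)]

theorem aestronglyMeasurable_olct (hT : IsComplexScaling φ T) {ν : Measure Y} [SFinite ν]
    (A : OLCTParam) {H : Y × ℝ → F} (hH : AEStronglyMeasurable H (ν.prod volume)) :
    AEStronglyMeasurable (fun p : Y × ℝ => olct T A (fun n => H (p.1, n)) p.2)
      (ν.prod volume) := by
  by_cases hb : A.b = 0
  · simp_rw [olct, if_pos hb]
    have hsubst : Measure.QuasiMeasurePreserving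
        (fun p : Y × ℝ => (p.1, A.d * (p.2 - A.r))) (ν.prod volume) (ν.prod volume) :=
      QuasiMeasurePreserving.prodMap (.id ν)
        (quasiMeasurePreserving_mul_sub (d_ne_zero_of_b_eq_zero hb) A.r)
    exact hT.aestronglyMeasurable_apply
      ((continuous_olctChirpC A).measurable.comp measurable_snd).aestronglyMeasurable
      (hH.comp_quasiMeasurePreserving hsubst)
  · simp_rw [olct, if_neg hb]
    have hker : AEStronglyMeasurable (fun p : (Y × ℝ) × ℝ => olctKernelC A p.2 p.1.2)
        ((ν.prod volume).prod volume) :=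
      (continuous_olctKernelC A continuous_snd continuous_fst).measurable.comp
        (by fun_prop : Measurable fun p : (Y × ℝ) × ℝ => (p.1.2, p.2)) |>.aestronglyMeasurable
    have hsubst : Measure.QuasiMeasurePreserving (fun p : (Y × ℝ) × ℝ => (p.1.1, p.2))
        ((ν.prod volume).prod volume) (ν.prod volume) :=
      QuasiMeasurePreserving.prodMap Measure.quasiMeasurePreserving_fst (.id volume)
    exact (hT.aestronglyMeasurable_apply hker
      (hH.comp_quasiMeasurePreserving hsubst)).integral_prod_right'

theorem ae_integrable_olct (hT : IsComplexScaling φ T) {ν : Measure Y} [SFinite ν]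
    (A : OLCTParam) {H : Y × ℝ → F} (hH : Integrable H (ν.prod volume)) :
    ∀ᵐ u, Integrable (fun y => olct T A (fun n => H (y, n)) u) ν := by
  by_cases hb : A.b = 0
  · simp_rw [olct, if_pos hb]
    have hsubst := quasiMeasurePreserving_mul_sub (d_ne_zero_of_b_eq_zero hb) A.r
    filter_upwards [hsubst.ae hH.prod_left_ae] with u hu
    exact hT.integrable_apply aestronglyMeasurable_const (fun _ => norm_sq_olctChirpC A u) hu
  · simp_rw [olct, if_neg hb]
    refine .of_forall fun u => ?_
    have hker : AEStronglyMeasurable (fun p : Y × ℝ => olctKernelC A p.2 u) (ν.prod volume) :=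
      (continuous_olctKernelC A continuous_id continuous_const).measurable.comp
        measurable_snd |>.aestronglyMeasurable
    exact (hT.integrable_apply hker (fun p => norm_sq_olctKernelC A p.2 u) hH).integral_prod_left

end

theorem lintegral_enorm_sq_olct [InnerProductSpace ℂ E] [CompleteSpace E] [CompleteSpace F]
    {φ : F →ₗᵢ[ℝ] E} {T : ℂ → F → F} (hT : IsComplexScaling φ T) (A : OLCTParam) {h : ℝ → F}
    (hh : Integrable h) (hh₂ : MemLp h 2) :
    ∫⁻ u, ‖olct T A h u‖ₑ ^ 2 = ∫⁻ n, ‖h n‖ₑ ^ 2 := by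
  have hφh : Integrable (φ ∘ h) := φ.toContinuousLinearMap.integrable_comp hh
  have hφh₂ : MemLp (φ ∘ h) 2 := φ.toContinuousLinearMap.comp_memLp' hh₂
  simp_rw [← φ.enorm_map (olct T A h _), hT.map_olct, lintegral_enorm_sq_olct_smul A hφh hφh₂,
    Function.comp_apply, φ.enorm_map]

end IsComplexScaling

end OneVariable

section Iterated

variable {F : Type*} [NormedAddCommGroup F]

theorem measurePreserving_prodAssoc_swap {X Y Z : Type*} [MeasurableSpace X] [MeasurableSpace Y]
    [MeasurableSpace Z] (μ : Measure X) (ν : Measure Y) (τ : Measure Z) [SFinite μ] [SFinite ν]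
    [SFinite τ] :
    MeasurePreserving (fun p : (X × Y) × Z => (p.1.1, (p.2, p.1.2))) ((μ.prod ν).prod τ)
      (μ.prod (τ.prod ν)) :=
  ((MeasurePreserving.id μ).prod Measure.measurePreserving_swap).comp
    (measurePreserving_prodAssoc μ ν τ)

theorem measurePreserving_prod_right_comm {X Y Z : Type*} [MeasurableSpace X] [MeasurableSpace Y]
    [MeasurableSpace Z] (μ : Measure X) (ν : Measure Y) (τ : Measure Z) [SFinite μ] [SFinite ν]
    [SFinite τ] :
    MeasurePreserving (fun p : (X × Y) × Z => ((p.1.1, p.2), p.1.2)) ((μ.prod ν).prod τ)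
      ((μ.prod τ).prod ν) :=
  ((measurePreserving_prodAssoc μ τ ν).symm _).comp (measurePreserving_prodAssoc_swap μ ν τ)

variable [NormedSpace ℝ F]

/-- The offset linear canonical transform in the variable `n₁`, with scalar multiplication `S`,
followed by the one in `n₂`, with scalar multiplication `T`. -/
noncomputable def iteratedOLCT (S T : ℂ → F → F) (A₁ A₂ : OLCTParam) (h : ℝ × ℝ → F)
    (u : ℝ × ℝ) : F :=
  olct T A₂ (fun n₂ => olct S A₁ (fun n₁ => h (n₁, n₂)) u.1) u.2

theorem aestronglyMeasurable_iteratedOLCT {E₁ E₂ Y : Type*} [NormedAddCommGroup E₁]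
    [NormedSpace ℂ E₁] [NormedAddCommGroup E₂] [NormedSpace ℂ E₂] [MeasurableSpace Y]
    {ν : Measure Y} [SFinite ν] {φ : F →ₗᵢ[ℝ] E₁} {ψ : F →ₗᵢ[ℝ] E₂} {S T : ℂ → F → F}
    (hS : IsComplexScaling φ S) (hT : IsComplexScaling ψ T) (A₁ A₂ : OLCTParam)
    {H : Y × (ℝ × ℝ) → F} (hH : AEStronglyMeasurable H (ν.prod volume)) :
    AEStronglyMeasurable
      (fun p : Y × (ℝ × ℝ) => iteratedOLCT S T A₁ A₂ (fun n => H (p.1, n)) p.2)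
      (ν.prod volume) := by
  have hinner : AEStronglyMeasurable
      (fun p : (Y × ℝ) × ℝ => olct S A₁ (fun n₁ => H (p.1.1, (n₁, p.1.2))) p.2)
      ((ν.prod volume).prod volume) :=
    hS.aestronglyMeasurable_olct A₁ (H := fun p : (Y × ℝ) × ℝ => H (p.1.1, (p.2, p.1.2)))
      (hH.comp_measurePreserving (measurePreserving_prodAssoc_swap ν volume volume))
  have hswapped : AEStronglyMeasurable
      (fun p : (Y × ℝ) × ℝ => olct S A₁ (fun n₁ => H (p.1.1, (n₁, p.2))) p.1.2)
      ((ν.prod volume).prod volume) :=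
    (hinner.comp_measurePreserving (measurePreserving_prod_right_comm ν volume volume) :)
  exact ((hT.aestronglyMeasurable_olct A₂ hswapped).comp_measurePreserving
    ((measurePreserving_prodAssoc ν volume volume).symm _) :)

variable [CompleteSpace F] {E₁ E₂ : Type*} [NormedAddCommGroup E₁] [InnerProductSpace ℂ E₁]
  [CompleteSpace E₁] [NormedAddCommGroup E₂] [InnerProductSpace ℂ E₂] [CompleteSpace E₂]
  {φ : F →ₗᵢ[ℝ] E₁} {ψ : F →ₗᵢ[ℝ] E₂} {S T : ℂ → F → F}

theorem lintegral_enorm_sq_partialOLCT (hS : IsComplexScaling φ S) (A : OLCTParam)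
    {h : ℝ × ℝ → F} (hh : Integrable h) (hh₂ : MemLp h 2) :
    ∫⁻ n₂, ∫⁻ u₁, ‖olct S A (fun n₁ => h (n₁, n₂)) u₁‖ₑ ^ 2 = ∫⁻ n, ‖h n‖ₑ ^ 2 := by
  rw [Measure.volume_eq_prod] at *
  rw [lintegral_prod_symm _ (hh₂.1.enorm.pow_const 2)]
  refine lintegral_congr_ae ?_
  filter_upwards [hh.prod_left_ae, ae_memLp_two_prodMk_left
    (hh₂.comp_measurePreserving Measure.measurePreserving_swap)] with n₂ hinteg hmem
  exact hS.lintegral_enorm_sq_olct A hinteg hmem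

theorem lintegral_enorm_sq_iteratedOLCT (hS : IsComplexScaling φ S) (hT : IsComplexScaling ψ T)
    (A₁ A₂ : OLCTParam) {h : ℝ × ℝ → F} (hh : Integrable h) (hh₂ : MemLp h 2) :
    ∫⁻ u, ‖iteratedOLCT S T A₁ A₂ h u‖ₑ ^ 2 = ∫⁻ n, ‖h n‖ₑ ^ 2 := by
  have hswap := Measure.measurePreserving_swap (μ := (volume : Measure ℝ))
    (ν := (volume : Measure ℝ))
  set g : ℝ × ℝ → F := fun p => olct S A₁ (fun n₁ => h (n₁, p.1)) p.2
  have hgm : AEStronglyMeasurable g (volume.prod volume) :=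
    hS.aestronglyMeasurable_olct A₁ (hh.1.comp_measurePreserving hswap)
  have hgnorm : ∫⁻ p, ‖g p‖ₑ ^ 2 ∂(volume.prod volume) = ∫⁻ n, ‖h n‖ₑ ^ 2 := by
    rw [lintegral_prod _ (hgm.enorm.pow_const 2), lintegral_enorm_sq_partialOLCT hS A₁ hh hh₂]
  have hg₂ : MemLp g 2 (volume.prod volume) :=
    memLp_two_of_lintegral_enorm_sq_ne_top hgm (hgnorm ▸ lintegral_enorm_sq_ne_top hh₂)
  have hm : AEStronglyMeasurable (iteratedOLCT S T A₁ A₂ h) (volume.prod volume) :=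
    hT.aestronglyMeasurable_olct A₂ (hgm.comp_measurePreserving hswap)
  rw [Measure.volume_eq_prod, lintegral_prod _ (hm.enorm.pow_const 2), ← Measure.volume_eq_prod,
    ← hgnorm, lintegral_prod_symm _ (hgm.enorm.pow_const 2)]
  refine lintegral_congr_ae ?_
  filter_upwards [hS.ae_integrable_olct A₁ (hswap.integrable_comp_of_integrable hh),
    ae_memLp_two_prodMk_left (hg₂.comp_measurePreserving hswap)] with u₁ hinteg hmem
  exact hT.lintegral_enorm_sq_olct (h := fun n₂ => g (n₂, u₁)) A₂ hinteg hmem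

end Iterated

section Quaternion

/-- The scalar multiplication of the complex structure on `ℍ` given by left multiplication by the
plane spanned by `1` and `i`. -/
noncomputable def leftScaling (z : ℂ) (q : ℍ) : ℍ := inPlane quatI z * q

/-- The scalar multiplication of the complex structure on `ℍ` given by right multiplication by the
plane spanned by `1` and `j`. -/
noncomputable def rightScaling (z : ℂ) (q : ℍ) : ℍ := q * inPlane quatJ z

/-- The coordinates of `(x₀ + x₁ i) + (x₂ + x₃ i) j`, linear over the plane `ℝ + ℝi` acting on the
left. -/
noncomputable def leftCoords : ℍ →ₗᵢ[ℝ] EuclideanSpace ℂ (Fin 2) where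
  toFun q := !₂[⟨q.re, q.imI⟩, ⟨q.imJ, q.imK⟩]
  map_add' p q := by ext i; fin_cases i <;> rfl
  map_smul' c q := by ext i; fin_cases i <;> simp [Complex.ext_iff]
  norm_map' q := by
    rw [← sq_eq_sq₀ (norm_nonneg _) (norm_nonneg q), EuclideanSpace.norm_sq_eq, Fin.sum_univ_two,
      sq ‖q‖, ← Quaternion.normSq_eq_norm_mul_self, Quaternion.normSq_def']
    simp [Complex.sq_norm, Complex.normSq_apply, ← sq, add_assoc]

/-- The coordinates of `(x₀ + x₂ j) + i (x₁ + x₃ j)`, linear over the plane `ℝ + ℝj` acting on the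
right. -/
noncomputable def rightCoords : ℍ →ₗᵢ[ℝ] EuclideanSpace ℂ (Fin 2) where
  toFun q := !₂[⟨q.re, q.imJ⟩, ⟨q.imI, q.imK⟩]
  map_add' p q := by ext i; fin_cases i <;> rfl
  map_smul' c q := by ext i; fin_cases i <;> simp [Complex.ext_iff]
  norm_map' q := by
    rw [← sq_eq_sq₀ (norm_nonneg _) (norm_nonneg q), EuclideanSpace.norm_sq_eq, Fin.sum_univ_two,
      sq ‖q‖, ← Quaternion.normSq_eq_norm_mul_self, Quaternion.normSq_def']
    simp [Complex.sq_norm, Complex.normSq_apply, ← sq, add_assoc, add_left_comm]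

theorem isComplexScaling_leftScaling : IsComplexScaling leftCoords leftScaling := by
  have hunit : quatI.re = 0 ∧ quatI.imI = 1 ∧ quatI.imJ = 0 ∧ quatI.imK = 0 :=
    ⟨rfl, rfl, rfl, rfl⟩
  intro z q
  ext i
  fin_cases i <;>
    simp [Complex.ext_iff, leftCoords, leftScaling, inPlane, hunit, Quaternion.re_mul,
      Quaternion.imI_mul, Quaternion.imJ_mul, Quaternion.imK_mul]

theorem isComplexScaling_rightScaling : IsComplexScaling rightCoords rightScaling := by
  have hunit : quatJ.re = 0 ∧ quatJ.imI = 0 ∧ quatJ.imJ = 1 ∧ quatJ.imK = 0 :=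
    ⟨rfl, rfl, rfl, rfl⟩
  intro z q
  ext i
  fin_cases i <;>
    simp [Complex.ext_iff, rightCoords, rightScaling, inPlane, hunit, Quaternion.re_mul,
      Quaternion.imI_mul, Quaternion.imJ_mul, Quaternion.imK_mul, mul_comm, add_comm]

theorem integral_mul_const_divisionRing {X R : Type*} [MeasurableSpace X] {μ : Measure X}
    [NormedDivisionRing R] [NormedAlgebra ℝ R] (f : X → R) (c : R) :
    ∫ x, f x * c ∂μ = (∫ x, f x ∂μ) * c := by
  rcases eq_or_ne c 0 with rfl | hc
  · simp
  by_cases hf : Integrable f μ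
  · exact integral_mul_const_of_integrable hf
  · rw [integral_undef hf, integral_undef (mt (integrable_mul_const_iff hc.isUnit f).mp hf),
      zero_mul]

theorem wvdQOLCT_eq_iteratedOLCT (A₁ A₂ : OLCTParam) {f g : ℝ × ℝ → ℍ} {t : ℝ × ℝ}
    (hfg : Integrable (corrProduct f g t)) (u : ℝ × ℝ) :
    wvdQOLCT A₁ A₂ f g t u =
      iteratedOLCT leftScaling rightScaling A₁ A₂ (corrProduct f g t) u := by
  by_cases hb₁ : A₁.b = 0 <;> by_cases hb₂ : A₂.b = 0 <;>
    simp only [wvdQOLCT, iteratedOLCT, olct, hb₁, hb₂, if_true, if_false]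
  · rfl
  · rfl
  · exact integral_mul_const_divisionRing _ _
  · have hleft := isComplexScaling_leftScaling.integrable_apply
      (continuous_olctKernelC A₁ continuous_fst continuous_const).aestronglyMeasurable
      (fun n => norm_sq_olctKernelC A₁ n.1 u.1) hfg
    have hboth := isComplexScaling_rightScaling.integrable_apply
      (continuous_olctKernelC A₂ continuous_snd continuous_const).aestronglyMeasurable
      (fun n => norm_sq_olctKernelC A₂ n.2 u.2) hleft
    have hfubini := integral_prod_symm _ hboth
    simp only [rightScaling, integral_mul_const_divisionRing] at hfubini
    exact hfubini

end Quaternion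

section Correlation

theorem measurePreserving_add_half_smul_sub_half_smul {V : Type*} [NormedAddCommGroup V]
    [NormedSpace ℝ V] [MeasurableSpace V] [BorelSpace V] [SecondCountableTopology V]
    (μ : Measure V) [SFinite μ] [μ.IsAddLeftInvariant] :
    MeasurePreserving (fun p : V × V => (p.1 + (1 / 2 : ℝ) • p.2, p.1 - (1 / 2 : ℝ) • p.2))
      (μ.prod μ) (μ.prod μ) := by
  have hskew : MeasurePreserving (fun p : V × V => (p.1, p.2 - (1 / 2 : ℝ) • p.1))
      (μ.prod μ) (μ.prod μ) :=
    (MeasurePreserving.id μ).skew_product (by fun_prop)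
      (.of_forall fun n => (measurePreserving_sub_right μ ((1 / 2 : ℝ) • n)).map_eq)
  have hshear := ((measurePreserving_prod_add_swap μ μ).comp hskew).comp
    Measure.measurePreserving_swap
  convert Measure.measurePreserving_swap.comp hshear using 1
  ext p : 1
  refine Prod.ext ?_ rfl
  change p.1 + (1 / 2 : ℝ) • p.2 = p.1 - (1 / 2 : ℝ) • p.2 + p.2
  module

theorem memLp_comp_add_smul {V F : Type*} [NormedAddCommGroup V] [NormedSpace ℝ V]
    [FiniteDimensional ℝ V] [MeasurableSpace V] [BorelSpace V] {μ : Measure V}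
    [μ.IsAddHaarMeasure] [NormedAddCommGroup F] {p : ENNReal} {f : V → F} (hf : MemLp f p μ)
    (t : V) {c : ℝ} (hc : c ≠ 0) : MemLp (fun n => f (t + c • n)) p μ := by
  have htrans : MemLp (fun n => f (t + n)) p (μ.map (c • ·)) := by
    rw [Measure.map_addHaar_smul μ hc]
    exact (hf.comp_measurePreserving (measurePreserving_add_left μ t)).smul_measure
      ENNReal.ofReal_ne_top
  exact (memLp_map_measure_iff htrans.1 (by fun_prop)).mp htrans

variable {f g : ℝ × ℝ → ℍ}

theorem aestronglyMeasurable_corrProduct (hf : AEStronglyMeasurable f)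
    (hg : AEStronglyMeasurable g) :
    AEStronglyMeasurable (fun p : (ℝ × ℝ) × (ℝ × ℝ) => corrProduct f g p.1 p.2) :=
  ((hf.comp_fst.mul hg.comp_snd.star).comp_measurePreserving
    (measurePreserving_add_half_smul_sub_half_smul volume) :)

theorem lintegral_enorm_sq_corrProduct (hf : AEStronglyMeasurable f)
    (hg : AEStronglyMeasurable g) :
    ∫⁻ p : (ℝ × ℝ) × (ℝ × ℝ), ‖corrProduct f g p.1 p.2‖ₑ ^ 2 =
      (∫⁻ x, ‖f x‖ₑ ^ 2) * ∫⁻ x, ‖g x‖ₑ ^ 2 := by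
  have hf₂ := hf.enorm.pow_const 2
  have hg₂ := hg.enorm.pow_const 2
  have hprod (t n : ℝ × ℝ) : ‖corrProduct f g t n‖ₑ ^ 2 =
      ‖f (t + (1 / 2 : ℝ) • n)‖ₑ ^ 2 * ‖g (t - (1 / 2 : ℝ) • n)‖ₑ ^ 2 := by
    rw [corrProduct, enorm_mul, mul_pow, ← ofReal_norm (star _), norm_star, ofReal_norm]
  have hsubst := measurePreserving_add_half_smul_sub_half_smul (volume : Measure (ℝ × ℝ))
  simp_rw [hprod]
  rw [← lintegral_prod_mul hf₂ hg₂, ← hsubst.map_eq,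
    lintegral_map' (hsubst.map_eq.symm ▸ hf₂.comp_fst.mul hg₂.comp_snd) hsubst.aemeasurable]
  rfl

theorem integrable_corrProduct (hf : MemLp f 2) (hg : MemLp g 2) (t : ℝ × ℝ) :
    Integrable (corrProduct f g t) := by
  have hf' := memLp_comp_add_smul hf t (c := 1 / 2) (by norm_num)
  have hg' := memLp_comp_add_smul hg t (c := -(1 / 2)) (by norm_num)
  simp only [neg_smul, ← sub_eq_add_neg] at hg'
  exact hf'.integrable_mul hg'.star

end Correlation

section WVD

variable {f g : ℝ × ℝ → ℍ}

theorem aestronglyMeasurable_wvdQOLCT (A₁ A₂ : OLCTParam) (hf : MemLp f 2) (hg : MemLp g 2) :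
    AEStronglyMeasurable (fun p : (ℝ × ℝ) × (ℝ × ℝ) => wvdQOLCT A₁ A₂ f g p.1 p.2) := by
  simp_rw [fun p : (ℝ × ℝ) × (ℝ × ℝ) =>
    wvdQOLCT_eq_iteratedOLCT A₁ A₂ (integrable_corrProduct hf hg p.1) p.2]
  exact (aestronglyMeasurable_iteratedOLCT isComplexScaling_leftScaling
    isComplexScaling_rightScaling A₁ A₂ (aestronglyMeasurable_corrProduct hf.1 hg.1) :)

theorem lintegral_enorm_sq_wvdQOLCT (A₁ A₂ : OLCTParam) (hf : MemLp f 2) (hg : MemLp g 2) :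
    ∫⁻ p : (ℝ × ℝ) × (ℝ × ℝ), ‖wvdQOLCT A₁ A₂ f g p.1 p.2‖ₑ ^ 2 =
      (∫⁻ x, ‖f x‖ₑ ^ 2) * ∫⁻ x, ‖g x‖ₑ ^ 2 := by
  have hW := aestronglyMeasurable_wvdQOLCT A₁ A₂ hf hg
  have hC := aestronglyMeasurable_corrProduct hf.1 hg.1
  have hCnorm := lintegral_enorm_sq_corrProduct hf.1 hg.1
  have hC₂ : MemLp (fun p : (ℝ × ℝ) × (ℝ × ℝ) => corrProduct f g p.1 p.2) 2
      (volume.prod volume) := by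
    refine memLp_two_of_lintegral_enorm_sq_ne_top hC (hCnorm.trans_ne ?_)
    exact ENNReal.mul_ne_top (lintegral_enorm_sq_ne_top hf) (lintegral_enorm_sq_ne_top hg)
  rw [← hCnorm, Measure.volume_eq_prod, lintegral_prod _ (hW.enorm.pow_const 2),
    lintegral_prod _ (hC.enorm.pow_const 2)]
  refine lintegral_congr_ae ?_
  filter_upwards [ae_memLp_two_prodMk_left hC₂] with t ht
  have hinteg := integrable_corrProduct hf hg t
  simp_rw [wvdQOLCT_eq_iteratedOLCT A₁ A₂ hinteg]
  exact lintegral_enorm_sq_iteratedOLCT isComplexScaling_leftScaling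
    isComplexScaling_rightScaling A₁ A₂ hinteg ht

end WVD

theorem theorem3p6 (A₁ A₂ : OLCTParam) (f g : ℝ × ℝ → ℍ)
    (hf : MemLp f 2 (volume : Measure (ℝ × ℝ)))
    (hg : MemLp g 2 (volume : Measure (ℝ × ℝ))) :
    MemLp (fun p : (ℝ × ℝ) × (ℝ × ℝ) => wvdQOLCT A₁ A₂ f g p.1 p.2) 2 volume ∧
    ∫ t : ℝ × ℝ, ∫ u : ℝ × ℝ, ‖wvdQOLCT A₁ A₂ f g t u‖ ^ 2 =
      (eLpNorm (fun p : (ℝ × ℝ) × (ℝ × ℝ) => wvdQOLCT A₁ A₂ f g p.1 p.2) 2 volume).toReal ^ 2 ∧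
    (eLpNorm (fun p : (ℝ × ℝ) × (ℝ × ℝ) => wvdQOLCT A₁ A₂ f g p.1 p.2) 2 volume).toReal ^ 2 =
      (eLpNorm f 2 volume).toReal ^ 2 * (eLpNorm g 2 volume).toReal ^ 2 := by
  have hmem : MemLp (fun p : (ℝ × ℝ) × (ℝ × ℝ) => wvdQOLCT A₁ A₂ f g p.1 p.2) 2 volume := by
    refine memLp_two_of_lintegral_enorm_sq_ne_top (aestronglyMeasurable_wvdQOLCT A₁ A₂ hf hg) ?_
    rw [lintegral_enorm_sq_wvdQOLCT A₁ A₂ hf hg]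
    exact ENNReal.mul_ne_top (lintegral_enorm_sq_ne_top hf) (lintegral_enorm_sq_ne_top hg)
  have hnorm := lintegral_enorm_sq_wvdQOLCT A₁ A₂ hf hg
  simp only [lintegral_enorm_sq_eq_eLpNorm_sq] at hnorm
  refine ⟨hmem, integral_integral_norm_sq_eq_eLpNorm_sq hmem, ?_⟩
  simp only [← ENNReal.toReal_pow, ← ENNReal.toReal_mul, hnorm]
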